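/- For binary words $a=a_1\cdots a_m$ and $w=w_1\cdots w_N$, say that $a$ is an \emph{internal subword} of $w$ if $w_i\cdots w_{i+m-1}=a$ for some $i$ with $1<i<N-m+1$. For a binary word $k$ of length $L\ge 1$ and $n\ge 1$, let $c_{k,n}$ be the number of binary words $b$ of length $n$ such that $k$ is not an internal subword of the concatenation $kbk$, and put $c_{k,0}=1$. The asymptotic growth rate of $k$ is $g_k=\lim_{n\to\infty} c_{k,n+1}/c_{k,n}$. For $L\ge 1$ let $$\alpha_L=\max\{|t| : t\in\mathbb{C},\ t^L-2t^{L-1}+1=0\}.$$ Let $L\ge 1$. For every binary word $k$ of length $L$ the limit $g_k$ exists, and $$g_{0\cdots 01}\le g_k\le g_{0\cdots 0},$$ where $0\cdots 0$ and $0\cdots 01$ are the words of length $L$ consisting of $L$ zeros, respectively of $L-1$ zeros followed by a one. In addition, $g_{0\cdots 0}=\alpha_{L+1}$ and $g_{0\cdots 01}=\alpha_L$. Finally, $\alpha_L\approx 2-2^{-L+1}$ for large $L$, in the sense that $$\lim_{L\to\infty}\frac{2-\alpha_L}{2^{-L+1}}=1.$$ -/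

import Mathlib

open Filter Topology Asymptotics

namespace UDOOC

/-- The word `a` is an internal subword of the word `b`: it occurs in `b` as a block of
consecutive letters that starts after the first letter of `b` and ends before the last one. -/
def IsInternalSubword (a b : List Bool) : Prop :=
  ∃ p s : List Bool, p ≠ [] ∧ s ≠ [] ∧ b = p ++ a ++ s

/-- The set of codewords of length `n` associated with the unique word `k`: the binary words `b`
of length `n` such that `k` is not an internal subword of `k b k`.  By convention the empty word
is always a codeword. -/
def codewords (k : List Bool) (n : ℕ) : Set (List Bool) :=
  {b | b.length = n ∧ (n = 0 ∨ ¬ IsInternalSubword k (k ++ b ++ k))}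

/-- A set of codewords of fixed length is finite, so counting it with `Set.ncard` is meaningful. -/
theorem codewords_finite (k : List Bool) (n : ℕ) : (codewords k n).Finite :=
  (List.finite_length_eq Bool n).subset fun _ hb => hb.1

/-- The number of codewords of length `n`. -/
noncomputable def codeCount (k : List Bool) (n : ℕ) : ℕ := (codewords k n).ncard

/-- The ratio of the numbers of codewords of lengths `n + 1` and `n`. -/
noncomputable def countRatio (k : List Bool) (n : ℕ) : ℝ :=
  (codeCount k (n + 1) : ℝ) / (codeCount k n : ℝ)

/-- The asymptotic growth rate: the limit of `countRatio k n` as `n → ∞`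
(meaningful when this limit exists). -/
noncomputable def growthRate (k : List Bool) : ℝ := limUnder atTop (countRatio k)

/-- The word `0…00` of length `L`. -/
def zeroWord (L : ℕ) : List Bool := List.replicate L false

/-- The word `0…01` of length `L` (for `1 ≤ L`). -/
def zeroOneWord (L : ℕ) : List Bool := List.replicate (L - 1) false ++ [true]

/-- The moduli of the complex roots of `t ^ L - 2 t ^ (L - 1) + 1`. -/
def rootModuli (L : ℕ) : Set ℝ :=
  {x | ∃ t : ℂ, t ^ L - 2 * t ^ (L - 1) + 1 = 0 ∧ x = ‖t‖}

/-- The largest modulus of a complex root of `t ^ L - 2 t ^ (L - 1) + 1`. -/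
noncomputable def alpha (L : ℕ) : ℝ := sSup (rootModuli L)

/-- For `1 ≤ L` the supremum that defines `alpha L` is a maximum. -/
theorem alpha_isGreatest (L : ℕ) (hL : 1 ≤ L) : IsGreatest (rootModuli L) (alpha L) := by
  have hne : (rootModuli L).Nonempty := ⟨‖(1 : ℂ)‖, 1, by norm_num, rfl⟩
  have hp : (Polynomial.X ^ L - 2 * Polynomial.X ^ (L - 1) + 1 : Polynomial ℂ) ≠ 0 := by
    intro h
    have h2 := congrArg (Polynomial.eval 0) h
    obtain ⟨m, rfl⟩ : ∃ m, L = m + 1 := ⟨L - 1, by omega⟩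
    rcases m with _ | m
    · norm_num at h2
    · norm_num at h2
  have hfin : (rootModuli L).Finite := by
    refine ((Polynomial.finite_setOfPred_isRoot hp).image fun t : ℂ => ‖t‖).subset ?_
    rintro x ⟨t, ht, rfl⟩
    exact ⟨t, by simpa [Polynomial.IsRoot] using ht, rfl⟩
  exact ⟨hne.csSup_mem hfin, fun x hx => le_csSup hfin.bddAbove hx⟩

end UDOOC

namespace UDOOC

open Finset

/-! Let `k` have length L and let c(z) be the sum of z^i over the periods i < L of `k`, its
autocorrelation polynomial. Three counting identities (`card_avoiders`, `two_mul_card_avoiders`,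
`two_mul_card_firstHits`) show that for n ≥ 1 the number of codewords of length n is the coefficient
of z^(n+L) in (2z-1)/D(z), where D(z) = (1-2z)c(z) + z^L. If D has a simple root ρ in (1/2, 1) and
no other root in |z| ≤ ρ, the coefficients times ρ^n tend to a nonzero limit
(`exists_tendsto_coeff`), so the growth rate is 1/ρ.

For L ≥ 3 such a root exists when 1 is not a period (`isDominantRoot_of_lt` and numerical bounds).
If 1 is a period, `k` is constant and (1-z)D(z) = 1 - 2z + z^(L+1), which is the denominator for
period set {0} and length L+1. The remaining words, of length 1 or 2, are treated directly.

For x ≥ 1/2 the value D(x) decreases as the period set grows. The root is therefore largest for the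
period set {0}, that of 0…01, and smallest for constant words. The substitution z = 1/t turns 1 - 2z
+ z^L into the polynomial defining `alpha L`, so `alpha L` = 1/ρ. Then 2 - 1/ρ = ρ^(L-1), and
(2ρ)^(L-1) = (1 + ρ^L)^(L-1) tends to 1. -/

/-! ### Counting words by the first occurrence of `k` -/

/-- The binary words of length `n`. -/
noncomputable def words (n : ℕ) : Finset (List Bool) := (List.finite_length_eq Bool n).toFinset

theorem mem_words {n : ℕ} {w : List Bool} : w ∈ words n ↔ w.length = n := by
  simp [words]

/-- The words of length `n` in which `k` does not occur. -/
noncomputable def avoiders (k : List Bool) (n : ℕ) : Finset (List Bool) := by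
  classical exact (words n).filter fun w => ¬ k <:+: w

/-- The words `w` of length `n` such that `k` occurs in `w ++ k` only at the end. -/
noncomputable def firstHits (k : List Bool) (n : ℕ) : Finset (List Bool) := by
  classical exact (words n).filter fun w => ¬ k <:+: (w ++ k).dropLast

/-- The periods of `k` that are smaller than its length. -/
noncomputable def periods (k : List Bool) : Finset ℕ := by
  classical exact (range k.length).filter fun i => k.drop i <+: k

theorem mem_avoiders {k w : List Bool} {n : ℕ} :
    w ∈ avoiders k n ↔ w.length = n ∧ ¬ k <:+: w := by
  simp [avoiders, mem_words]

theorem mem_firstHits {k w : List Bool} {n : ℕ} :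
    w ∈ firstHits k n ↔ w.length = n ∧ ¬ k <:+: (w ++ k).dropLast := by
  simp [firstHits, mem_words]

theorem mem_periods {k : List Bool} {i : ℕ} :
    i ∈ periods k ↔ i < k.length ∧ k.drop i <+: k := by
  simp [periods]

theorem zero_mem_periods {k : List Bool} (hk : k ≠ []) : 0 ∈ periods k := by
  simp [mem_periods, List.length_pos_iff, hk]

theorem periods_subset (k : List Bool) : periods k ⊆ range k.length :=
  fun _ hi => mem_range.2 (mem_periods.1 hi).1

theorem prefix_dropLast_of_prefix {α : Type*} {a b c : List α} (ha : a <+: c) (hb : b <+: c)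
    (h : a.length < b.length) : a <+: b.dropLast := by
  refine List.prefix_of_prefix_length_le ha ((List.dropLast_prefix b).trans hb) ?_
  rw [List.length_dropLast]; omega

/-- Both `w` and `w'` mark where `k` first occurs in `x`. This gives injectivity in `card_avoiders`.
-/
theorem eq_of_append_prefix {k w w' x : List Bool} (hw : ¬ k <:+: (w ++ k).dropLast)
    (hw' : ¬ k <:+: (w' ++ k).dropLast) (h : w ++ k <+: x) (h' : w' ++ k <+: x) : w = w' := by
  have key : ∀ {u u' : List Bool}, ¬ k <:+: (u' ++ k).dropLast → u ++ k <+: x → u' ++ k <+: x →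
      u'.length ≤ u.length := by
    intro u u' hu' h1 h2
    by_contra hlt
    refine hu' ((List.suffix_append u k).isInfix.trans (prefix_dropLast_of_prefix h1 h2 ?_).isInfix)
    simp; omega
  have hl : w.length = w'.length := le_antisymm (key hw h' h) (key hw' h h')
  have hp : w ++ k <+: w' ++ k := List.prefix_of_prefix_length_le h h' (by simp [hl])
  exact (List.append_inj (hp.eq_of_length (by simp [hl])) hl).1

theorem append_prefix_of_mem_periods {k : List Bool} {i : ℕ} (hi : i ∈ periods k) (w : List Bool) :
    w ++ k <+: (w ++ k.take i) ++ k := by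
  rw [List.append_assoc, List.prefix_append_right_inj]
  conv_lhs => rw [← List.take_append_drop i k]
  rw [List.prefix_append_right_inj]
  exact (mem_periods.1 hi).2

theorem append_take_mem_avoiders {k w : List Bool} {i j : ℕ} (hi : i ∈ periods k)
    (hw : w ∈ firstHits k j) : w ++ k.take i ∈ avoiders k (i + j) := by
  obtain ⟨hil, -⟩ := mem_periods.1 hi
  obtain ⟨hwl, hwk⟩ := mem_firstHits.1 hw
  refine mem_avoiders.2 ⟨by simp [hwl]; omega, fun h => hwk (h.trans ?_)⟩
  refine (prefix_dropLast_of_prefix (c := w ++ k) ?_ (List.prefix_refl _) ?_).isInfix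
  · rw [List.prefix_append_right_inj]; exact List.take_prefix _ _
  · simp; omega

/-- Take the first occurrence of `k` in `v ++ k`. Since `v` avoids `k`, this occurrence overlaps the
final copy of `k` or coincides with it, and the shift between the two is a period. -/
theorem exists_firstHit_of_avoider {k v : List Bool} (hv : ¬ k <:+: v) :
    ∃ w i, i ∈ periods k ∧ w ∈ firstHits k w.length ∧ v = w ++ k.take i := by
  classical
  have hex : ∃ m, ∃ w : List Bool, w.length = m ∧ w ++ k <+: v ++ k :=
    ⟨_, v, rfl, List.prefix_refl _⟩
  obtain ⟨w, hwl, hw⟩ := Nat.find_spec hex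
  have hmin : ∀ p : List Bool, p ++ k <+: v ++ k → w.length ≤ p.length := fun p hp => by
    rw [hwl]; exact Nat.find_min' hex ⟨p, rfl, hp⟩
  have hwv : w <+: v := List.prefix_of_prefix_length_le ((List.prefix_append w k).trans hw)
    (List.prefix_append v k) (hmin v (List.prefix_refl _))
  obtain ⟨x, rfl⟩ := hwv
  have hkx : k <+: x ++ k := by
    rw [List.append_assoc, List.prefix_append_right_inj] at hw; exact hw
  have hxl : x.length < k.length := by
    by_contra hlt
    have : k <+: x := List.prefix_of_prefix_length_le hkx (List.prefix_append x k) (by omega)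
    exact hv (this.isInfix.trans (List.suffix_append w x).isInfix)
  have hxk : x <+: k := List.prefix_of_prefix_length_le (List.prefix_append x k) hkx hxl.le
  have hxt : x = k.take x.length := List.prefix_iff_eq_take.1 hxk
  refine ⟨w, x.length, mem_periods.2 ⟨hxl, ?_⟩, mem_firstHits.2 ⟨rfl, ?_⟩, by rw [← hxt]⟩
  · obtain ⟨y, rfl⟩ := hxk
    rw [List.prefix_append_right_inj] at hkx
    simpa using hkx
  · rintro ⟨p, q, hpq⟩
    have h1 : p ++ k <+: (w ++ k).dropLast := ⟨q, hpq⟩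
    have h2 := hmin p ((h1.trans (List.dropLast_prefix _)).trans hw)
    have h3 := congrArg List.length hpq
    simp at h3
    omega

theorem card_avoiders (k : List Bool) (n : ℕ) :
    (avoiders k n).card =
      ∑ p ∈ antidiagonal n, if p.1 ∈ periods k then (firstHits k p.2).card else 0 := by
  classical
  rw [← sum_filter, ← card_sigma]
  symm
  refine card_bij (fun a _ => a.2 ++ k.take a.1.1) ?_ ?_ ?_
  · rintro ⟨⟨i, j⟩, w⟩ h
    simp only [mem_sigma, mem_filter, HasAntidiagonal.mem_antidiagonal] at h
    rw [← h.1.1]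
    exact append_take_mem_avoiders h.1.2 h.2
  · rintro ⟨⟨i, j⟩, w⟩ h ⟨⟨i', j'⟩, w'⟩ h' he
    simp only [mem_sigma, mem_filter, HasAntidiagonal.mem_antidiagonal] at h h' he
    have h1 := append_prefix_of_mem_periods h.1.2 w
    have h2 := append_prefix_of_mem_periods h'.1.2 w'
    rw [he] at h1
    obtain ⟨hl, hw⟩ := mem_firstHits.1 h.2
    obtain ⟨hl', hw'⟩ := mem_firstHits.1 h'.2
    obtain rfl := eq_of_append_prefix hw hw' h1 h2
    obtain rfl : j = j' := by rw [← hl, ← hl']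
    obtain rfl : i = i' := by omega
    rfl
  · intro v hv
    obtain ⟨hl, hv⟩ := mem_avoiders.1 hv
    obtain ⟨w, i, hi, hw, rfl⟩ := exists_firstHit_of_avoider hv
    refine ⟨⟨(i, w.length), w⟩, ?_, rfl⟩
    have := (mem_periods.1 hi).1
    simp only [mem_sigma, mem_filter, HasAntidiagonal.mem_antidiagonal]
    refine ⟨⟨?_, hi⟩, hw⟩
    rw [← hl]; simp; omega

theorem card_filter_dropLast (P : List Bool → Prop) [DecidablePred P] (n : ℕ) :
    ((words (n + 1)).filter fun w => P w.dropLast).card = 2 * ((words n).filter P).card := by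
  classical
  rw [mul_comm, ← Fintype.card_bool, ← Finset.card_univ, ← card_product]
  symm
  refine card_bij (fun a _ => a.1 ++ [a.2]) ?_ ?_ ?_
  · rintro ⟨w, x⟩ h
    simp_all [mem_words]
  · rintro ⟨w, x⟩ h ⟨w', x'⟩ h' he
    simpa using he
  · intro v hv
    simp only [mem_filter, mem_words] at hv
    obtain rfl | ⟨w, x, rfl⟩ := v.eq_nil_or_concat
    · simp at hv
    · exact ⟨(w, x), by simpa [mem_words] using hv, by simp⟩

theorem card_filter_tail (P : List Bool → Prop) [DecidablePred P] (n : ℕ) :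
    ((words (n + 1)).filter fun w => P w.tail).card = 2 * ((words n).filter P).card := by
  classical
  rw [mul_comm, ← Fintype.card_bool, ← Finset.card_univ, ← card_product]
  symm
  refine card_bij (fun a _ => a.2 :: a.1) ?_ ?_ ?_
  · rintro ⟨w, x⟩ h
    simp_all [mem_words]
  · rintro ⟨w, x⟩ h ⟨w', x'⟩ h' he
    simp at he
    simp [he]
  · rintro (_ | ⟨x, w⟩) hv
    · simp [mem_words] at hv
    · exact ⟨(w, x), by simpa [mem_words] using hv, by simp⟩

theorem infix_iff_suffix_or_dropLast {α : Type*} {k v : List α} (hk : k ≠ []) :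
    k <:+: v ↔ k <:+ v ∨ k <:+: v.dropLast := by
  obtain rfl | ⟨w, x, rfl⟩ := v.eq_nil_or_concat
  · simp [hk]
  · simpa using List.infix_concat_iff

theorem infix_iff_prefix_or_tail {α : Type*} {k v : List α} (hk : k ≠ []) :
    k <:+: v ↔ k <+: v ∨ k <:+: v.tail := by
  cases v with
  | nil => simp [hk]
  | cons x t => exact List.infix_cons_iff

/-- Append a letter to an avoider: either the result still avoids `k`, or `k` occurs for the first
time at its end, and the result is `w ++ k` with `w` a first hit. -/
theorem two_mul_card_avoiders {k : List Bool} (hk : k ≠ []) (n : ℕ) :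
    2 * (avoiders k n).card = (avoiders k (n + 1)).card +
      if k.length ≤ n + 1 then (firstHits k (n + 1 - k.length)).card else 0 := by
  classical
  have h0 := card_filter_dropLast (fun w => ¬ k <:+: w) n
  rw [avoiders]
  rw [← h0, ← card_filter_add_card_filter_not (fun w => ¬ k <:+: w)]
  congr 1
  · congr 1
    ext v
    simp only [mem_filter, mem_words, mem_avoiders, infix_iff_suffix_or_dropLast (v := v) hk]
    tauto
  · split_ifs with hn
    · symm
      refine card_bij (fun w _ => w ++ k) ?_ ?_ ?_
      · intro w hw
        obtain ⟨hl, hw⟩ := mem_firstHits.1 hw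
        simp only [mem_filter, mem_words, not_not]
        exact ⟨⟨by simp; omega, hw⟩, (List.suffix_append w k).isInfix⟩
      · intro w _ w' _ he
        exact List.append_cancel_right he
      · intro v hv
        simp only [mem_filter, mem_words, not_not] at hv
        obtain ⟨⟨hl, hd⟩, hv⟩ := hv
        obtain ⟨w, rfl⟩ := ((infix_iff_suffix_or_dropLast hk).1 hv).resolve_right hd
        refine ⟨w, mem_firstHits.2 ⟨?_, hd⟩, rfl⟩
        simp at hl; omega
    · rw [card_eq_zero, filter_eq_empty_iff]
      intro v hv h
      simp only [mem_filter, mem_words, not_not] at hv h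
      have := h.length_le
      omega

theorem isInternalSubword_iff {a b : List Bool} (ha : a ≠ []) :
    IsInternalSubword a b ↔ a <:+: b.tail.dropLast := by
  constructor
  · rintro ⟨p, s, hp, hs, rfl⟩
    obtain ⟨x, p, rfl⟩ := List.exists_cons_of_ne_nil hp
    refine ⟨p, s.dropLast, ?_⟩
    rw [List.append_assoc, List.append_assoc, List.cons_append, List.tail_cons, ← List.append_assoc,
      ← List.append_assoc, List.dropLast_append_of_ne_nil hs]
  · rintro ⟨p, s, h⟩
    cases b with
    | nil => simp [ha] at h
    | cons x t =>
      obtain rfl | ⟨t, y, rfl⟩ := t.eq_nil_or_concat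
      · simp [ha] at h
      · refine ⟨x :: p, s ++ [y], by simp, by simp, ?_⟩
        simp at h
        simp [← h]

/-- Prepend a letter to a first hit: either the result is again a first hit, or it begins with `k`
and is `k ++ b`. In the second case the absence of other occurrences says exactly that `b` is a
codeword. The convention for the empty word forces `n ≠ 0`. -/
theorem two_mul_card_firstHits {k : List Bool} (hk : k ≠ []) {n : ℕ} (hn : n ≠ 0) :
    2 * (firstHits k (n + k.length - 1)).card =
      (firstHits k (n + k.length)).card + codeCount k n := by
  classical
  have hkl := List.length_pos_iff.2 hk
  have h0 := card_filter_tail (fun w => ¬ k <:+: (w ++ k).dropLast) (n + k.length - 1)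
  have h1 : n + k.length - 1 + 1 = n + k.length := by omega
  have htail : ∀ v : List Bool, v.length = n + k.length →
      (v ++ k).dropLast.tail = (v.tail ++ k).dropLast := by
    intro v hv
    cases v with
    | nil => simp at hv; omega
    | cons x t => simp [List.dropLast_append_of_ne_nil hk, List.dropLast_cons_of_ne_nil, hk]
  rw [firstHits]
  rw [← h0, h1, ← card_filter_add_card_filter_not (fun w => ¬ k <:+: (w ++ k).dropLast)]
  congr 1
  · congr 1
    ext v
    simp only [mem_filter, mem_words, mem_firstHits, and_assoc]
    refine and_congr_right fun hv => ?_
    rw [infix_iff_prefix_or_tail (v := (v ++ k).dropLast) hk, htail v hv]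
    tauto
  · rw [codeCount, Set.ncard_eq_toFinset_card _ (codewords_finite k n)]
    symm
    refine card_bij (fun w _ => k ++ w) ?_ ?_ ?_
    · intro b hb
      simp only [codewords, isInternalSubword_iff hk, Set.Finite.mem_toFinset, Set.mem_ofPred_eq,
        hn, false_or] at hb
      simp only [mem_filter, mem_words, not_not]
      have hl : (k ++ b).length = n + k.length := by simp [hb.1]; omega
      refine ⟨⟨hl, ?_⟩, ?_⟩
      · have : (k ++ b ++ k).tail = (k ++ b).tail ++ k := by
          cases k with
          | nil => simp at hkl
          | cons x t => simp
        rw [← this]; exact hb.2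
      · refine (prefix_dropLast_of_prefix (c := k ++ b ++ k) ?_ (List.prefix_refl _) ?_).isInfix
        · rw [List.append_assoc]; exact List.prefix_append _ _
        · simp; omega
    · intro w _ w' _ he
      exact List.append_cancel_left he
    · intro v hv
      simp only [mem_filter, mem_words, not_not] at hv
      obtain ⟨⟨hl, hd⟩, hv⟩ := hv
      rw [infix_iff_prefix_or_tail hk, htail v hl, or_iff_left hd] at hv
      obtain ⟨b, rfl⟩ := List.prefix_of_prefix_length_le (hv.trans (List.dropLast_prefix _))
        (List.prefix_append v k) (by omega)
      refine ⟨b, ?_, rfl⟩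
      simp only [codewords, isInternalSubword_iff hk, Set.Finite.mem_toFinset, Set.mem_ofPred_eq,
        hn, false_or]
      refine ⟨by simp at hl; omega, ?_⟩
      have : (k ++ b ++ k).tail = (k ++ b).tail ++ k := by
        cases k with
        | nil => simp at hkl
        | cons x t => simp
      rw [this]; exact hd

/-! ### Generating functions -/

/-- The generating function of `firstHits`. -/
noncomputable def firstHitSeries (k : List Bool) : PowerSeries ℂ :=
  PowerSeries.mk fun n => ((firstHits k n).card : ℂ)

/-- The autocorrelation polynomial of a set of periods. -/
noncomputable def corrPoly (S : Finset ℕ) : Polynomial ℂ := ∑ i ∈ S, Polynomial.X ^ i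

/-- The denominator of the generating functions for a word of length `L` with periods `S`. -/
noncomputable def denomPoly (S : Finset ℕ) (L : ℕ) : Polynomial ℂ :=
  (1 - 2 * Polynomial.X) * corrPoly S + Polynomial.X ^ L

theorem coeff_corrPoly (S : Finset ℕ) (n : ℕ) : (corrPoly S).coeff n = if n ∈ S then 1 else 0 := by
  simp [corrPoly, Polynomial.finsetSum_coeff, Polynomial.coeff_X_pow]

theorem denomPoly_mul_firstHitSeries {k : List Bool} (hk : k ≠ []) :
    (denomPoly (periods k) k.length : PowerSeries ℂ) * firstHitSeries k = 1 := by
  have hV : PowerSeries.mk (fun n => ((avoiders k n).card : ℂ)) =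
      (corrPoly (periods k) : PowerSeries ℂ) * firstHitSeries k := by
    ext n
    rw [PowerSeries.coeff_mul, PowerSeries.coeff_mk, card_avoiders, Nat.cast_sum]
    refine sum_congr rfl fun p _ => ?_
    rw [Polynomial.coeff_coe, coeff_corrPoly, firstHitSeries, PowerSeries.coeff_mk]
    split_ifs <;> simp
  have h2 : (1 - 2 * PowerSeries.X) * PowerSeries.mk (fun n => ((avoiders k n).card : ℂ)) =
      1 - PowerSeries.X ^ k.length * firstHitSeries k := by
    ext n
    have hkl := List.length_pos_iff.2 hk
    have h00 : (avoiders k 0).card = 1 := by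
      rw [card_eq_one]
      refine ⟨[], ?_⟩
      ext w
      simp only [mem_avoiders, List.length_eq_zero_iff, mem_singleton, and_iff_left_iff_imp]
      rintro rfl; simpa using hk
    cases n with
    | zero =>
      simp [sub_mul, mul_assoc, h00, hk]
    | succ n =>
      have h := congrArg (Nat.cast (R := ℂ)) (two_mul_card_avoiders hk n)
      have h2 : (2 : PowerSeries ℂ) = PowerSeries.C (2 : ℂ) := (map_ofNat PowerSeries.C 2).symm
      push_cast at h
      simp only [sub_mul, one_mul, mul_assoc, map_sub, PowerSeries.coeff_mk, h2,
        PowerSeries.coeff_C_mul, PowerSeries.coeff_succ_X_mul, h, PowerSeries.coeff_X_pow_mul',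
        firstHitSeries, PowerSeries.coeff_one]
      simp
  rw [hV] at h2
  rw [denomPoly]
  have hc : ((2 : Polynomial ℂ) : PowerSeries ℂ) = 2 :=
    map_ofNat Polynomial.coeToPowerSeries.ringHom 2
  push_cast
  rw [hc]
  linear_combination h2

/-! ### Coefficient asymptotics from a dominant simple pole -/

/-- The coefficients of `F` are absolutely summable with weights `ρ ^ n`. -/
def WeightSummable (ρ : ℂ) (F : PowerSeries ℂ) : Prop :=
  Summable fun n => ‖PowerSeries.coeff n F * ρ ^ n‖

theorem coeff_mul_mul_pow (F G : PowerSeries ℂ) (ρ : ℂ) (n : ℕ) :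
    PowerSeries.coeff n (F * G) * ρ ^ n = ∑ p ∈ antidiagonal n,
      (PowerSeries.coeff p.1 F * ρ ^ p.1) * (PowerSeries.coeff p.2 G * ρ ^ p.2) := by
  rw [PowerSeries.coeff_mul, sum_mul]
  refine sum_congr rfl fun p hp => ?_
  rw [← HasAntidiagonal.mem_antidiagonal.1 hp, pow_add]; ring

theorem WeightSummable.mul {ρ : ℂ} {F G : PowerSeries ℂ} (hF : WeightSummable ρ F)
    (hG : WeightSummable ρ G) : WeightSummable ρ (F * G) := by
  simpa only [WeightSummable, coeff_mul_mul_pow] using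
    summable_norm_sum_mul_antidiagonal_of_summable_norm hF hG

theorem WeightSummable.tsum_mul {ρ : ℂ} {F G : PowerSeries ℂ} (hF : WeightSummable ρ F)
    (hG : WeightSummable ρ G) :
    ∑' n, PowerSeries.coeff n (F * G) * ρ ^ n =
      (∑' n, PowerSeries.coeff n F * ρ ^ n) * ∑' n, PowerSeries.coeff n G * ρ ^ n := by
  simpa only [coeff_mul_mul_pow] using
    (tsum_mul_tsum_eq_tsum_sum_antidiagonal_of_summable_norm hF hG).symm

theorem weightSummable_coe (ρ : ℂ) (P : Polynomial ℂ) : WeightSummable ρ (P : PowerSeries ℂ) := by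
  refine summable_of_ne_finset_zero (s := range (P.natDegree + 1)) fun n hn => ?_
  rw [Polynomial.coeff_coe, Polynomial.coeff_eq_zero_of_natDegree_lt (by simpa using hn)]
  simp

theorem tsum_coe (ρ : ℂ) (P : Polynomial ℂ) :
    ∑' n, PowerSeries.coeff n (P : PowerSeries ℂ) * ρ ^ n = P.eval ρ := by
  rw [tsum_eq_sum (s := range (P.natDegree + 1)), Polynomial.eval_eq_sum_range]
  · simp
  · intro n hn
    rw [Polynomial.coeff_coe, Polynomial.coeff_eq_zero_of_natDegree_lt (by simpa using hn)]
    simp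

theorem exists_weightSummable_inverse_linear {ρ z : ℂ} (h : ‖ρ‖ < ‖z‖) :
    ∃ G : PowerSeries ℂ, ((Polynomial.X - Polynomial.C z : Polynomial ℂ) : PowerSeries ℂ) * G = 1 ∧
      WeightSummable ρ G := by
  have hz : z ≠ 0 := norm_pos_iff.1 ((norm_nonneg ρ).trans_lt h)
  refine ⟨PowerSeries.mk fun n => -(z⁻¹) ^ (n + 1), ?_, ?_⟩
  · ext n
    cases n with
    | zero => simp [sub_mul, hz]
    | succ n =>
      simp only [Polynomial.coe_sub, Polynomial.coe_X, Polynomial.coe_C, sub_mul, map_sub,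
        PowerSeries.coeff_succ_X_mul, PowerSeries.coeff_mk, PowerSeries.coeff_C_mul,
        PowerSeries.coeff_one]
      rw [pow_succ _ (n + 1)]
      field_simp
      simp
  · have hs : Summable fun n : ℕ => ‖z⁻¹‖ * ‖ρ / z‖ ^ n := by
      refine Summable.mul_left _ (summable_geometric_of_lt_one (norm_nonneg _) ?_)
      rw [norm_div, div_lt_one (by positivity)]; exact h
    refine hs.congr fun n => ?_
    simp [pow_succ, div_eq_mul_inv, mul_pow]
    ring

/-- Over ℂ the polynomial splits. Each linear factor has a geometric series as inverse, and
summability survives Cauchy products. -/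
theorem exists_weightSummable_inverse {ρ : ℂ} {F : Polynomial ℂ}
    (hF : ∀ z, ‖z‖ ≤ ‖ρ‖ → F.eval z ≠ 0) :
    ∃ G : PowerSeries ℂ, (F : PowerSeries ℂ) * G = 1 ∧ WeightSummable ρ G := by
  have hF0 : F ≠ 0 := by
    rintro rfl; exact hF 0 (by simp) (by simp)
  have key : ∀ s : Multiset ℂ, (∀ z ∈ s, ‖ρ‖ < ‖z‖) → ∃ G : PowerSeries ℂ,
      (((s.map fun z => Polynomial.X - Polynomial.C z).prod : Polynomial ℂ) : PowerSeries ℂ) * G = 1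
        ∧ WeightSummable ρ G := by
    intro s
    induction s using Multiset.induction_on with
    | empty =>
      intro _
      refine ⟨1, by simp, by simpa using weightSummable_coe ρ 1⟩
    | cons z s ih =>
      intro h
      obtain ⟨G, h1, h2⟩ := ih fun w hw => h w (Multiset.mem_cons_of_mem hw)
      obtain ⟨G', h1', h2'⟩ := exists_weightSummable_inverse_linear (h z (Multiset.mem_cons_self z s))
      refine ⟨G' * G, ?_, h2'.mul h2⟩
      rw [Multiset.map_cons, Multiset.prod_cons, Polynomial.coe_mul, mul_mul_mul_comm, h1, h1',
        one_mul]
  obtain ⟨G, h1, h2⟩ := key F.roots fun z hz => by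
    by_contra hle
    exact hF z (not_lt.1 hle) (Polynomial.mem_roots'.1 hz).2
  refine ⟨((Polynomial.C F.leadingCoeff⁻¹ : Polynomial ℂ) : PowerSeries ℂ) * G, ?_,
    (weightSummable_coe _ _).mul h2⟩
  have hl : F.leadingCoeff ≠ 0 := Polynomial.leadingCoeff_ne_zero.2 hF0
  rw [show (F : PowerSeries ℂ) = _ from
    congrArg Polynomial.toPowerSeries (IsAlgClosed.splits F).eq_prod_roots]
  rw [Polynomial.coe_mul, mul_mul_mul_comm, h1, mul_one, ← Polynomial.coe_mul, ← Polynomial.C_mul,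
    mul_inv_cancel₀ hl]
  simp

/-- An elementary substitute for singularity analysis: (X - ρ)U = N/F is absolutely summable at ρ,
and its partial sums there telescope to -ρ times the n-th coefficient of U times ρ^n. The limit is
nonzero because N(ρ)/F(ρ) is. -/
theorem exists_tendsto_coeff {ρ : ℂ} (hρ : ρ ≠ 0) {F N : Polynomial ℂ} {U : PowerSeries ℂ}
    (hF : ∀ z, ‖z‖ ≤ ‖ρ‖ → F.eval z ≠ 0) (hN : N.eval ρ ≠ 0)
    (h : (((Polynomial.X - Polynomial.C ρ) * F : Polynomial ℂ) : PowerSeries ℂ) * U = N) :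
    ∃ s ≠ 0, Tendsto (fun n => PowerSeries.coeff n U * ρ ^ n) atTop (𝓝 s) := by
  obtain ⟨G, hG, hGs⟩ := exists_weightSummable_inverse hF
  have hs := (weightSummable_coe ρ N).mul hGs
  set H := (N : PowerSeries ℂ) * G with hH
  have hU : (PowerSeries.X - PowerSeries.C ρ) * U = H := by
    rw [hH, ← h]
    push_cast
    linear_combination -(PowerSeries.X - PowerSeries.C ρ) * U * hG
  have hval : ∑' n, PowerSeries.coeff n H * ρ ^ n ≠ 0 := by
    rw [hH, (weightSummable_coe ρ N).tsum_mul hGs, tsum_coe]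
    refine mul_ne_zero hN fun h0 => ?_
    have h1 := (weightSummable_coe ρ F).tsum_mul hGs
    rw [hG, h0, mul_zero, ← Polynomial.coe_one, tsum_coe] at h1
    simp at h1
  have hpart : ∀ n, ∑ i ∈ range (n + 1), PowerSeries.coeff i H * ρ ^ i =
      -ρ * (PowerSeries.coeff n U * ρ ^ n) := by
    intro n
    induction n with
    | zero => simp [← hU, sub_mul]
    | succ n ih =>
      rw [sum_range_succ, ih, ← hU]
      simp only [sub_mul, map_sub, PowerSeries.coeff_succ_X_mul, PowerSeries.coeff_C_mul]
      ring
  have ht : Tendsto (fun n => ∑ i ∈ range (n + 1), PowerSeries.coeff i H * ρ ^ i) atTop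
      (𝓝 (∑' n, PowerSeries.coeff n H * ρ ^ n)) :=
    (hs.of_norm.hasSum.tendsto_sum_nat).comp (tendsto_add_atTop_nat 1)
  refine ⟨(-ρ)⁻¹ * _, mul_ne_zero (inv_ne_zero (neg_ne_zero.2 hρ)) hval,
    (ht.const_mul (-ρ)⁻¹).congr fun n => ?_⟩
  rw [hpart, inv_mul_cancel_left₀ (neg_ne_zero.2 hρ)]

theorem tendsto_ratio_of_tendsto {c : ℕ → ℝ} {ρ : ℝ} (hρ : ρ ≠ 0) {s : ℂ} (hs : s ≠ 0)
    (h : Tendsto (fun n => (c n : ℂ) * (ρ : ℂ) ^ n) atTop (𝓝 s)) :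
    Tendsto (fun n => c (n + 1) / c n) atTop (𝓝 (1 / ρ)) := by
  have hr : Tendsto (fun n => c n * ρ ^ n) atTop (𝓝 s.re) :=
    ((Complex.continuous_re.tendsto s).comp h).congr fun n => by
      simp [← Complex.ofReal_pow, ← Complex.ofReal_mul]
  have hre : s.re ≠ 0 := by
    intro h0
    refine hs (tendsto_nhds_unique h ?_)
    have := (Complex.continuous_ofReal.tendsto s.re).comp hr
    rw [h0, Complex.ofReal_zero] at this
    exact this.congr fun n => by simp
  have := ((hr.comp (tendsto_add_atTop_nat 1)).div hr hre).div_const ρ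
  rw [div_self hre] at this
  refine this.congr fun n => ?_
  have : ρ ^ n ≠ 0 := pow_ne_zero _ hρ
  simp only [Function.comp, Pi.div_apply, pow_succ]
  -- When `c n = 0`, both sides vanish because division by zero gives zero.
  by_cases hc : c n = 0
  · simp [hc]
  · field_simp

/-! ### The dominant root of the denominator -/

/-- The value of `denomPoly` at a real number. -/
def denom (S : Finset ℕ) (L : ℕ) (x : ℝ) : ℝ := (1 - 2 * x) * ∑ i ∈ S, x ^ i + x ^ L

theorem eval_corrPoly (S : Finset ℕ) (z : ℂ) : (corrPoly S).eval z = ∑ i ∈ S, z ^ i := by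
  simp [corrPoly, Polynomial.eval_finsetSum]

theorem eval_denomPoly (S : Finset ℕ) (L : ℕ) (z : ℂ) :
    (denomPoly S L).eval z = (1 - 2 * z) * ∑ i ∈ S, z ^ i + z ^ L := by
  simp [denomPoly, eval_corrPoly]

theorem eval_denomPoly_ofReal (S : Finset ℕ) (L : ℕ) (x : ℝ) :
    (denomPoly S L).eval (x : ℂ) = (denom S L x : ℝ) := by
  rw [eval_denomPoly, denom]; push_cast; ring

/-- `ρ` is a simple root of `denomPoly S L` in `(1/2, 1)` and the only root of modulus
at most `ρ`. -/
structure IsDominantRoot (S : Finset ℕ) (L : ℕ) (ρ : ℝ) : Prop where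
  half_lt : 1 / 2 < ρ
  lt_one : ρ < 1
  exists_factor : ∃ F : Polynomial ℂ, (∀ z, ‖z‖ ≤ ρ → F.eval z ≠ 0) ∧
    denomPoly S L = (Polynomial.X - Polynomial.C (ρ : ℂ)) * F

theorem one_le_sum_pow {S : Finset ℕ} (h0 : 0 ∈ S) {x : ℝ} (hx : 0 ≤ x) : 1 ≤ ∑ i ∈ S, x ^ i := by
  simpa using single_le_sum (f := fun i => x ^ i) (fun i _ => pow_nonneg hx i) h0

/-- The absence of 1 from `S` keeps the term ρ out of the bound; with ρ > 1/2 that term would ruin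
it. -/
theorem one_sub_le_norm_corr {S : Finset ℕ} {L : ℕ} (hS : S ⊆ range L) (h0 : 0 ∈ S) (h1 : 1 ∉ S)
    {ρ : ℝ} (hρ : 0 ≤ ρ) {z : ℂ} (hz : ‖z‖ ≤ ρ) :
    1 - ∑ i ∈ Ico 2 L, ρ ^ i ≤ ‖∑ i ∈ S, z ^ i‖ := by
  rw [← add_sum_erase S _ h0, pow_zero]
  have h2 : ‖∑ i ∈ S.erase 0, z ^ i‖ ≤ ∑ i ∈ Ico 2 L, ρ ^ i := by
    refine (norm_sum_le _ _).trans ?_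
    refine (sum_le_sum fun i _ => ?_).trans
      (sum_le_sum_of_subset_of_nonneg ?_ fun i _ _ => pow_nonneg hρ i)
    · rw [norm_pow]; exact pow_le_pow_left₀ (norm_nonneg z) hz i
    · intro i hi
      obtain ⟨hi0, hiS⟩ := mem_erase.1 hi
      have := mem_range.1 (hS hiS)
      have : i ≠ 1 := by rintro rfl; exact h1 hiS
      rw [mem_Ico]; omega
  have h3 := norm_sub_le (1 + ∑ i ∈ S.erase 0, z ^ i) (∑ i ∈ S.erase 0, z ^ i)
  rw [add_sub_cancel_right, norm_one] at h3
  linarith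

theorem norm_geom_sum₂_le {ρ : ℝ} (hρ : 0 ≤ ρ) {z : ℂ} (hz : ‖z‖ ≤ ρ) {L i : ℕ} (hi : i < L) :
    ‖(z * ρ) ^ i * ∑ j ∈ range (L - i), z ^ j * (ρ : ℂ) ^ (L - i - 1 - j)‖ ≤
      L * ρ ^ (L - 1) * ρ ^ i := by
  have hρn : ‖(ρ : ℂ)‖ = ρ := by simp [abs_of_nonneg hρ]
  have h1 : ‖∑ j ∈ range (L - i), z ^ j * (ρ : ℂ) ^ (L - i - 1 - j)‖ ≤ L * ρ ^ (L - i - 1) := by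
    refine (norm_sum_le_of_le _ (f := fun j => z ^ j * (ρ : ℂ) ^ (L - i - 1 - j))
      (n := fun _ => ρ ^ (L - i - 1)) fun j hj => ?_).trans ?_
    · rw [norm_mul, norm_pow, norm_pow, hρn]
      refine (mul_le_mul_of_nonneg_right (pow_le_pow_left₀ (norm_nonneg z) hz j)
        (pow_nonneg hρ _)).trans_eq ?_
      rw [← pow_add]; congr 1
      have := mem_range.1 hj; omega
    · rw [sum_const, card_range, nsmul_eq_mul]
      refine mul_le_mul_of_nonneg_right ?_ (pow_nonneg hρ _)
      exact_mod_cast Nat.sub_le L i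
  rw [norm_mul, norm_pow, norm_mul, hρn]
  calc (‖z‖ * ρ) ^ i * _ ≤ (ρ * ρ) ^ i * (L * ρ ^ (L - i - 1)) := by gcongr
    _ = L * (ρ ^ i * ρ ^ (L - i - 1)) * ρ ^ i := by ring
    _ = L * ρ ^ (L - 1) * ρ ^ i := by
        rw [← pow_add]; congr 4; omega

/-- Divide D by z - ρ explicitly. In |z| ≤ ρ the quotient is a multiple of c(z), bounded below by
`one_sub_le_norm_corr`, plus a sum bounded above by `norm_geom_sum₂_le`; `hb` makes the first term
win. -/
theorem isDominantRoot_of_lt {S : Finset ℕ} {L : ℕ} (hS : S ⊆ range L) (h0 : 0 ∈ S)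
    (h1 : 1 ∉ S) {ρ : ℝ} (hhalf : 1 / 2 < ρ) (hone : ρ < 1) (hroot : denom S L ρ = 0)
    (hb : L * ρ ^ (L - 1) < 2 * (1 - ∑ i ∈ Ico 2 L, ρ ^ i)) : IsDominantRoot S L ρ := by
  have hρ : 0 ≤ ρ := by linarith
  set a : ℂ := ∑ i ∈ S, (ρ : ℂ) ^ i with ha
  set r : ℝ := ∑ i ∈ S, ρ ^ i with hr
  have har : a = (r : ℂ) := by rw [ha, hr]; push_cast; rfl
  have hr1 : 1 ≤ r := one_le_sum_pow h0 hρ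
  have ha0 : a ≠ 0 := by
    rw [har]; exact_mod_cast (by linarith : r ≠ 0)
  have hroot' : (1 - 2 * (ρ : ℂ)) * a + (ρ : ℂ) ^ L = 0 := by
    rw [ha, ← eval_denomPoly, eval_denomPoly_ofReal, hroot, Complex.ofReal_zero]
  -- With a = c(ρ) and D(ρ) = 0, a·D(z) = a·D(z) - c(z)·D(ρ) = -2a(z-ρ)c(z) + Σ (zρ)^i (z^(L-i) -
  -- ρ^(L-i)), and each difference is divisible by z - ρ.
  set T : Polynomial ℂ := -2 * Polynomial.C a * corrPoly S +
    ∑ i ∈ S, (Polynomial.X * Polynomial.C (ρ : ℂ)) ^ i *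
      ∑ j ∈ range (L - i), Polynomial.X ^ j * Polynomial.C (ρ : ℂ) ^ (L - i - 1 - j) with hT
  have hTe : ∀ z, T.eval z = -2 * a * ∑ i ∈ S, z ^ i +
      ∑ i ∈ S, (z * ρ) ^ i * ∑ j ∈ range (L - i), z ^ j * (ρ : ℂ) ^ (L - i - 1 - j) := by
    intro z
    simp [hT, Polynomial.eval_finsetSum, eval_corrPoly, mul_comm z (ρ : ℂ)]
  have hfac : Polynomial.C a * denomPoly S L = (Polynomial.X - Polynomial.C (ρ : ℂ)) * T := by
    refine Polynomial.funext fun z => ?_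
    have hs : (∑ i ∈ S, (z * ρ) ^ i * ∑ j ∈ range (L - i), z ^ j * (ρ : ℂ) ^ (L - i - 1 - j)) *
        (z - ρ) = z ^ L * a - (ρ : ℂ) ^ L * ∑ i ∈ S, z ^ i := by
      rw [ha, sum_mul, mul_sum, mul_sum, ← sum_sub_distrib]
      refine sum_congr rfl fun i hi => ?_
      rw [mul_assoc, geom_sum₂_mul, mul_pow]
      have hl : L = i + (L - i) := by have := mem_range.1 (hS hi); omega
      conv_rhs => rw [hl, pow_add, pow_add]
      ring
    rw [Polynomial.eval_mul, Polynomial.eval_mul, hTe, eval_denomPoly]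
    simp only [Polynomial.eval_C, Polynomial.eval_sub, Polynomial.eval_X]
    linear_combination (∑ i ∈ S, z ^ i) * hroot' - hs
  refine ⟨hhalf, hone, Polynomial.C a⁻¹ * T, fun z hz => ?_, ?_⟩
  · rw [Polynomial.eval_mul, Polynomial.eval_C]
    refine mul_ne_zero (inv_ne_zero ha0) fun hz0 => ?_
    rw [hTe] at hz0
    have h2 : ‖∑ i ∈ S, (z * ρ) ^ i * ∑ j ∈ range (L - i), z ^ j * (ρ : ℂ) ^ (L - i - 1 - j)‖ ≤
        L * ρ ^ (L - 1) * r := by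
      rw [hr, mul_sum]
      exact norm_sum_le_of_le _ fun i hi => norm_geom_sum₂_le hρ hz (mem_range.1 (hS hi))
    have h3 := one_sub_le_norm_corr hS h0 h1 hρ hz
    have h4 : ‖2 * a * ∑ i ∈ S, z ^ i‖ = 2 * r * ‖∑ i ∈ S, z ^ i‖ := by
      rw [norm_mul, norm_mul, har, Complex.norm_real, Real.norm_of_nonneg (by linarith)]; simp
    have h5 : 2 * a * ∑ i ∈ S, z ^ i =
        ∑ i ∈ S, (z * ρ) ^ i * ∑ j ∈ range (L - i), z ^ j * (ρ : ℂ) ^ (L - i - 1 - j) := by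
      linear_combination -hz0
    rw [← h5, h4] at h2
    have h6 : (L * ρ ^ (L - 1)) * r < 2 * (1 - ∑ i ∈ Ico 2 L, ρ ^ i) * r :=
      mul_lt_mul_of_pos_right hb (by linarith)
    have h7 : r * (1 - ∑ i ∈ Ico 2 L, ρ ^ i) ≤ r * ‖∑ i ∈ S, z ^ i‖ :=
      mul_le_mul_of_nonneg_left h3 (by linarith)
    linarith
  · rw [mul_left_comm, ← hfac, ← mul_assoc, ← Polynomial.C_mul, inv_mul_cancel₀ ha0]
    simp

theorem continuous_denom (S : Finset ℕ) (L : ℕ) : Continuous (denom S L) := by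
  unfold denom; fun_prop

/-- At 1/2 only the positive term x^L survives. At `b` the factor 1 - 2b is negative and the sum is
at least 1, so one condition free of `S` suffices. -/
theorem exists_root_denom {S : Finset ℕ} {L : ℕ} (h0 : 0 ∈ S) {b : ℝ} (hb : 1 / 2 < b)
    (hneg : 1 - 2 * b + b ^ L < 0) : ∃ ρ, 1 / 2 < ρ ∧ ρ < b ∧ denom S L ρ = 0 := by
  have h1 : 0 < denom S L (1 / 2) := by simp [denom]
  have h2 : denom S L b < 0 := by
    have := one_le_sum_pow h0 (by linarith : 0 ≤ b)
    rw [denom]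
    nlinarith
  obtain ⟨ρ, ⟨h3, h4⟩, h5⟩ :=
    intermediate_value_Ioo' hb.le (continuous_denom S L).continuousOn ⟨h2, h1⟩
  exact ⟨ρ, h3, h4, h5⟩

/-- Passing from n to n+1 multiplies the left side by ρ(n+1)/n, at most 1 for n ≥ 4 and ρ ≤ 4/5. -/
theorem mul_pow_pred_le {ρ : ℝ} (h0 : 0 ≤ ρ) (h1 : ρ ≤ 4 / 5) {L : ℕ} (hL : 4 ≤ L) :
    L * ρ ^ (L - 1) ≤ 4 * ρ ^ 3 := by
  induction L, hL using Nat.le_induction with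
  | base => norm_num
  | succ n hn ih =>
    refine le_trans ?_ ih
    obtain ⟨m, rfl⟩ : ∃ m, n = m + 1 := ⟨n - 1, by omega⟩
    have hm : (3 : ℝ) ≤ m := by exact_mod_cast (by omega : 3 ≤ m)
    simp only [Nat.add_sub_cancel, pow_succ]
    push_cast
    have := pow_nonneg h0 m
    nlinarith [mul_le_mul_of_nonneg_left h1 (by linarith : (0 : ℝ) ≤ m + 1 + 1)]

theorem exists_isDominantRoot_of_four_le {S : Finset ℕ} {L : ℕ} (hL : 4 ≤ L) (hS : S ⊆ range L)
    (h0 : 0 ∈ S) (h1 : 1 ∉ S) : ∃ ρ, IsDominantRoot S L ρ ∧ ρ < 68 / 125 := by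
  have hpow : (68 / 125 : ℝ) ^ L ≤ (68 / 125) ^ 4 :=
    pow_le_pow_of_le_one (by norm_num) (by norm_num) hL
  -- 68/125 lies just above the root 0.5437 of 1 - 2x + x^4, and is small enough for 4ρ^3 < 2(1 -
  -- ρ^2/(1-ρ)).
  obtain ⟨ρ, h2, h3, h4⟩ := exists_root_denom (L := L) h0 (b := 68 / 125) (by norm_num)
    (by norm_num at hpow ⊢; linarith)
  refine ⟨ρ, isDominantRoot_of_lt hS h0 h1 h2 (by linarith) h4 ?_, h3⟩
  have hρ : 0 ≤ ρ := by linarith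
  have h5 := mul_pow_pred_le hρ (by linarith) hL
  have h6 := geom_sum_Ico_le_of_lt_one (m := 2) (n := L) hρ (by linarith)
  have h7 : ρ ^ 3 ≤ (68 / 125) ^ 3 := pow_le_pow_left₀ hρ h3.le 3
  have h8 : ρ ^ 2 / (1 - ρ) ≤ (68 / 125) ^ 2 / (1 - 68 / 125) := by
    have : (0 : ℝ) < 1 - 68 / 125 := by norm_num
    gcongr
  norm_num at h7 h8
  linarith

theorem exists_isDominantRoot {S : Finset ℕ} {L : ℕ} (hL : 3 ≤ L) (hS : S ⊆ range L)
    (h0 : 0 ∈ S) (h1 : 1 ∉ S) : ∃ ρ, IsDominantRoot S L ρ := by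
  obtain hL | rfl := hL.lt_or_eq
  · obtain ⟨ρ, hρ, -⟩ := exists_isDominantRoot_of_four_le hL hS h0 h1
    exact ⟨ρ, hρ⟩
  -- 619/1000 lies just above the root 0.6180 of 1 - 2x + x^3, and below √(2/5), as 3ρ^2 < 2(1 -
  -- ρ^2) requires.
  · obtain ⟨ρ, h2, h3, h4⟩ := exists_root_denom (L := 3) h0 (b := 619 / 1000) (by norm_num)
      (by norm_num)
    refine ⟨ρ, isDominantRoot_of_lt hS h0 h1 h2 (by linarith) h4 ?_⟩
    rw [show Ico 2 3 = {2} from rfl, sum_singleton]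
    norm_num
    nlinarith

namespace IsDominantRoot

variable {S : Finset ℕ} {L : ℕ} {ρ : ℝ}

theorem denom_eq_zero (h : IsDominantRoot S L ρ) : denom S L ρ = 0 := by
  obtain ⟨F, -, hF⟩ := h.exists_factor
  have := eval_denomPoly_ofReal S L ρ
  rw [hF] at this
  simpa using this.symm

theorem le_norm_of_root (h : IsDominantRoot S L ρ) {z : ℂ} (hz : (denomPoly S L).eval z = 0) :
    ρ ≤ ‖z‖ := by
  obtain ⟨F, hF0, hF⟩ := h.exists_factor
  by_contra! hlt
  rw [hF, Polynomial.eval_mul, mul_eq_zero, or_iff_left (hF0 z hlt.le)] at hz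
  have : z = ρ := by simpa [sub_eq_zero] using hz
  rw [this, Complex.norm_real, Real.norm_of_nonneg (by linarith [h.half_lt])] at hlt
  exact lt_irrefl _ hlt

theorem le_of_denom_nonpos (h : IsDominantRoot S L ρ) (h0 : 0 ∈ S) (hL : L ≠ 0) {x : ℝ}
    (hx : 0 ≤ x) (hd : denom S L x ≤ 0) : ρ ≤ x := by
  have h1 : 0 ≤ denom S L 0 := by
    have := one_le_sum_pow h0 le_rfl
    simp [denom, hL] at this ⊢
    linarith
  obtain ⟨y, ⟨hy0, hyx⟩, hy⟩ :=
    intermediate_value_Icc' hx (continuous_denom S L).continuousOn ⟨hd, h1⟩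
  have := h.le_norm_of_root (z := (y : ℂ)) (by rw [eval_denomPoly_ofReal, hy, Complex.ofReal_zero])
  rw [Complex.norm_real, Real.norm_of_nonneg hy0] at this
  linarith

theorem exists_tendsto_coeff (h : IsDominantRoot S L ρ) {U : PowerSeries ℂ} {N : Polynomial ℂ}
    (hN : N.eval (ρ : ℂ) ≠ 0) (hU : (denomPoly S L : PowerSeries ℂ) * U = N) :
    ∃ s ≠ 0, Tendsto (fun n => PowerSeries.coeff n U * (ρ : ℂ) ^ n) atTop (𝓝 s) := by
  obtain ⟨F, hF0, hF⟩ := h.exists_factor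
  have hρ : 0 < ρ := by linarith [h.half_lt]
  refine UDOOC.exists_tendsto_coeff (by exact_mod_cast hρ.ne') (F := F) (N := N) (fun z hz => ?_)
    hN (by rw [← hF]; exact hU)
  exact hF0 z (by simpa [abs_of_pos hρ] using hz)

end IsDominantRoot

/-! ### Growth rates from dominant roots -/

/-- A power series whose coefficients from `k.length` on are the numbers of codewords. -/
noncomputable def codeSeries (k : List Bool) : PowerSeries ℂ :=
  (2 * PowerSeries.X - 1) * firstHitSeries k

theorem coeff_codeSeries {k : List Bool} (hk : k ≠ []) {n : ℕ} (hn : n ≠ 0) :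
    PowerSeries.coeff (n + k.length) (codeSeries k) = codeCount k n := by
  have h := congrArg (Nat.cast (R := ℂ)) (two_mul_card_firstHits hk hn)
  obtain ⟨m, hm⟩ : ∃ m, n + k.length = m + 1 := ⟨n + k.length - 1, by omega⟩
  have h2 : (2 : PowerSeries ℂ) = PowerSeries.C (2 : ℂ) := (map_ofNat PowerSeries.C 2).symm
  rw [hm] at h ⊢
  push_cast at h
  simp only [codeSeries, firstHitSeries, sub_mul, one_mul, mul_assoc, map_sub, h2,
    PowerSeries.coeff_C_mul, PowerSeries.coeff_succ_X_mul, PowerSeries.coeff_mk]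
  linear_combination h

theorem coe_ofNat_two : ((2 : Polynomial ℂ) : PowerSeries ℂ) = 2 :=
  map_ofNat Polynomial.coeToPowerSeries.ringHom 2

theorem denomPoly_mul_codeSeries {k : List Bool} (hk : k ≠ []) :
    (denomPoly (periods k) k.length : PowerSeries ℂ) * codeSeries k =
      ((2 * Polynomial.X - 1 : Polynomial ℂ) : PowerSeries ℂ) := by
  rw [codeSeries, mul_left_comm, denomPoly_mul_firstHitSeries hk]
  push_cast
  rw [coe_ofNat_two, mul_one]

theorem tendsto_countRatio_of_coeff {k : List Bool} (hk : k ≠ []) {ρ : ℝ} (hρ : ρ ≠ 0) {s : ℂ}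
    (hs : s ≠ 0)
    (h : Tendsto (fun n => PowerSeries.coeff n (codeSeries k) * (ρ : ℂ) ^ n) atTop (𝓝 s)) :
    Tendsto (countRatio k) atTop (𝓝 (1 / ρ)) := by
  have hρ' : (ρ : ℂ) ≠ 0 := by exact_mod_cast hρ
  have h1 := ((tendsto_add_atTop_iff_nat k.length).2 h).div_const ((ρ : ℂ) ^ k.length)
  refine tendsto_ratio_of_tendsto (c := fun n => (codeCount k n : ℝ)) hρ
    (div_ne_zero hs (pow_ne_zero k.length hρ')) (h1.congr' ?_)
  filter_upwards [eventually_ne_atTop 0] with n hn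
  rw [coeff_codeSeries hk hn, pow_add]
  push_cast
  field_simp

theorem IsDominantRoot.tendsto_countRatio {k : List Bool} {ρ : ℝ} (hk : k ≠ [])
    (h : IsDominantRoot (periods k) k.length ρ) : Tendsto (countRatio k) atTop (𝓝 (1 / ρ)) := by
  obtain ⟨s, hs, ht⟩ := h.exists_tendsto_coeff (N := 2 * Polynomial.X - 1) (by
    have := h.half_lt
    simp only [Polynomial.eval_sub, Polynomial.eval_mul, Polynomial.eval_ofNat, Polynomial.eval_X,
      Polynomial.eval_one]
    have h1 : ((2 * ρ - 1 : ℝ) : ℂ) ≠ 0 := Complex.ofReal_ne_zero.2 (by linarith)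
    simpa using h1) (denomPoly_mul_codeSeries hk)
  exact tendsto_countRatio_of_coeff hk (by linarith [h.half_lt]) hs ht

theorem one_sub_mul_denomPoly_range (L : ℕ) :
    (1 - Polynomial.X) * denomPoly (range L) L = denomPoly {0} (L + 1) := by
  have h := geom_sum_mul (Polynomial.X : Polynomial ℂ) L
  simp only [denomPoly, corrPoly, sum_singleton, pow_zero]
  linear_combination (2 * Polynomial.X - 1) * h

theorem one_sub_mul_denom_range (L : ℕ) (x : ℝ) :
    (1 - x) * denom (range L) L x = denom {0} (L + 1) x := by
  have h := geom_sum_mul x L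
  simp only [denom, sum_singleton, pow_zero]
  linear_combination (2 * x - 1) * h

/-- Multiplying numerator and denominator by 1 - X replaces the full period set by {0} at length
L+1; the new numerator stays nonzero at ρ since ρ < 1. -/
theorem IsDominantRoot.tendsto_countRatio_of_periods_eq_range {k : List Bool} {ρ : ℝ}
    (hk : k ≠ []) (hp : periods k = range k.length) (h : IsDominantRoot {0} (k.length + 1) ρ) :
    Tendsto (countRatio k) atTop (𝓝 (1 / ρ)) := by
  obtain ⟨s, hs, ht⟩ := h.exists_tendsto_coeff (U := codeSeries k)
    (N := (1 - Polynomial.X) * (2 * Polynomial.X - 1)) (by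
    have h1 := h.half_lt
    have h2 := h.lt_one
    simp only [Polynomial.eval_sub, Polynomial.eval_mul, Polynomial.eval_ofNat, Polynomial.eval_X,
      Polynomial.eval_one]
    have h3 : (((1 - ρ) * (2 * ρ - 1) : ℝ) : ℂ) ≠ 0 :=
      Complex.ofReal_ne_zero.2 (mul_ne_zero (by linarith) (by linarith))
    simpa using h3) (by
    rw [← one_sub_mul_denomPoly_range, Polynomial.coe_mul, Polynomial.coe_mul, mul_assoc, ← hp,
      denomPoly_mul_codeSeries hk])
  exact tendsto_countRatio_of_coeff hk (by linarith [h.half_lt]) hs ht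

/-! ### Period sets of the extremal words -/

theorem eq_replicate_of_prefix_cons {α : Type*} {x : α} {t : List α} (h : t <+: x :: t) :
    x :: t = List.replicate (t.length + 1) x := by
  induction t generalizing x with
  | nil => rfl
  | cons y t ih =>
    obtain ⟨rfl, h'⟩ := List.cons_prefix_cons.1 h
    rw [ih h']
    simp [List.replicate_succ]

theorem periods_replicate (n : ℕ) (x : Bool) : periods (List.replicate n x) = range n := by
  ext i
  simp only [mem_periods, List.length_replicate, List.drop_replicate, mem_range,
    and_iff_left_iff_imp]
  intro hi
  exact ⟨List.replicate i x, by rw [List.replicate_append_replicate]; congr 1; omega⟩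

theorem periods_eq_range_of_one_mem {k : List Bool} (h : 1 ∈ periods k) :
    periods k = range k.length := by
  obtain ⟨hl, hp⟩ := mem_periods.1 h
  cases k with
  | nil => simp at hl
  | cons x t =>
    rw [eq_replicate_of_prefix_cons (by simpa using hp), periods_replicate, List.length_replicate]

theorem length_zeroOneWord {L : ℕ} (hL : 1 ≤ L) : (zeroOneWord L).length = L := by
  simp [zeroOneWord]; omega

/-- A proper nonempty suffix ends in 1, while a proper prefix contains only zeros. -/
theorem periods_zeroOneWord {L : ℕ} (hL : 1 ≤ L) : periods (zeroOneWord L) = {0} := by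
  ext i
  rw [mem_periods, length_zeroOneWord hL, mem_singleton]
  constructor
  · rintro ⟨hi, hp⟩
    by_contra hi0
    have hd : (zeroOneWord L).drop i = List.replicate (L - 1 - i) false ++ [true] := by
      rw [zeroOneWord, List.drop_append_of_le_length (by simp; omega), List.drop_replicate]
    have h2 : (zeroOneWord L).drop i <+: List.replicate (L - 1) false :=
      List.prefix_of_prefix_length_le hp (List.prefix_append _ _) (by simp [hd]; omega)
    have := List.eq_of_mem_replicate (h2.subset (a := true) (by simp [hd]))
    simp at this
  · rintro rfl
    exact ⟨hL, by simp⟩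

theorem denom_le_denom_of_subset {S S' : Finset ℕ} (h : S ⊆ S') (L : ℕ) {x : ℝ} (hx : 1 / 2 ≤ x) :
    denom S' L x ≤ denom S L x := by
  have : ∑ i ∈ S, x ^ i ≤ ∑ i ∈ S', x ^ i :=
    sum_le_sum_of_subset_of_nonneg h fun i _ _ => pow_nonneg (by linarith) i
  unfold denom
  nlinarith

/-! ### The numbers `alpha L`, and words of length 1 and 2 -/

theorem alpha_eq_of_isGreatest {L : ℕ} (hL : 1 ≤ L) {x : ℝ} (h : IsGreatest (rootModuli L) x) :
    alpha L = x :=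
  (alpha_isGreatest L hL).unique h

theorem alpha_one : alpha 1 = 1 := by
  refine alpha_eq_of_isGreatest le_rfl ⟨⟨1, by norm_num, by simp⟩, ?_⟩
  rintro _ ⟨t, ht, rfl⟩
  have : t = 1 := by linear_combination ht
  simp [this]

theorem alpha_two : alpha 2 = 1 := by
  refine alpha_eq_of_isGreatest (by norm_num) ⟨⟨1, by norm_num, by simp⟩, ?_⟩
  rintro _ ⟨t, ht, rfl⟩
  have h2 : (t - 1) ^ 2 = 0 := by linear_combination ht
  have : t = 1 := sub_eq_zero.1 (pow_eq_zero_iff (two_ne_zero)|>.1 h2)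
  simp [this]

theorem IsDominantRoot.alpha_eq {L : ℕ} (hL : 2 ≤ L) {ρ : ℝ} (h : IsDominantRoot {0} L ρ) :
    alpha L = 1 / ρ := by
  have hρ : 0 < ρ := by linarith [h.half_lt]
  have hρ' : (ρ : ℂ) ≠ 0 := by exact_mod_cast hρ.ne'
  obtain ⟨m, rfl⟩ : ∃ m, L = m + 1 := ⟨L - 1, by omega⟩
  refine alpha_eq_of_isGreatest (by omega) ⟨⟨1 / ρ, ?_, ?_⟩, ?_⟩
  · have h1 : (denomPoly {0} (m + 1)).eval (ρ : ℂ) = 0 := by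
      rw [eval_denomPoly_ofReal, h.denom_eq_zero, Complex.ofReal_zero]
    rw [eval_denomPoly] at h1
    simp only [sum_singleton, pow_zero, mul_one, pow_succ] at h1
    simp only [Nat.add_sub_cancel, one_div, inv_pow, pow_succ]
    field_simp
    linear_combination h1
  · rw [norm_div, norm_one, Complex.norm_real, Real.norm_of_nonneg hρ.le]
  · rintro _ ⟨t, ht, rfl⟩
    have ht0 : t ≠ 0 := by
      rintro rfl
      simp [show m ≠ 0 by omega] at ht
    have h1 := h.le_norm_of_root (z := t⁻¹) (by
      rw [eval_denomPoly]
      simp only [Nat.add_sub_cancel, pow_succ] at ht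
      simp only [sum_singleton, pow_zero, inv_pow, pow_succ]
      field_simp
      linear_combination ht)
    rw [norm_inv] at h1
    rw [one_div]
    exact (le_inv_comm₀ hρ (norm_pos_iff.2 ht0)).1 h1

/-- Here D = 1 - z has its root at 1, outside the range of `IsDominantRoot`, but the coefficient
lemma still applies with ρ = 1. -/
theorem tendsto_countRatio_of_length_one {k : List Bool} (hk : k.length = 1) :
    Tendsto (countRatio k) atTop (𝓝 1) := by
  have hk0 : k ≠ [] := by rintro rfl; simp at hk
  have hp : periods k = {0} := by
    refine subset_antisymm ?_ (singleton_subset_iff.2 (zero_mem_periods hk0))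
    have := periods_subset k
    rwa [hk] at this
  have h := denomPoly_mul_codeSeries hk0
  rw [hp, hk] at h
  have hD : denomPoly {0} 1 = (Polynomial.X - Polynomial.C 1) * (-1) := by
    simp [denomPoly, corrPoly]; ring
  rw [hD] at h
  obtain ⟨s, hs, ht⟩ := exists_tendsto_coeff one_ne_zero (F := -1) (by simp) (by norm_num) h
  have := tendsto_countRatio_of_coeff hk0 (ρ := 1) one_ne_zero hs (by simpa using ht)
  simpa using this

/-- D = (1 - z)^2 has a double root, so the series is computed: its n-th coefficient is n - 1, and
the shift by 2 gives n + 1 codewords. -/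
theorem tendsto_countRatio_of_length_two {k : List Bool} (hk : k.length = 2)
    (h1 : 1 ∉ periods k) : Tendsto (countRatio k) atTop (𝓝 1) := by
  have hk0 : k ≠ [] := by rintro rfl; simp at hk
  have hp : periods k = {0} := by
    refine subset_antisymm (fun i hi => ?_) (singleton_subset_iff.2 (zero_mem_periods hk0))
    have h2 := (mem_periods.1 hi).1
    have : i ≠ 1 := by rintro rfl; exact h1 hi
    rw [mem_singleton]; omega
  have h := denomPoly_mul_codeSeries hk0
  rw [hp, hk] at h
  have hD : denomPoly {0} 2 = (1 - Polynomial.X) * (1 - Polynomial.X) := by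
    simp [denomPoly, corrPoly]; ring
  have hM : (((1 - Polynomial.X) * (1 - Polynomial.X) : Polynomial ℂ) : PowerSeries ℂ) *
      PowerSeries.mk (fun n => (n : ℂ) - 1) =
      ((2 * Polynomial.X - 1 : Polynomial ℂ) : PowerSeries ℂ) := by
    push_cast
    rw [coe_ofNat_two, show (2 : PowerSeries ℂ) = PowerSeries.C (2 : ℂ) from
      (map_ofNat PowerSeries.C 2).symm]
    ext n
    rcases n with _ | _ | n
    · simp [sub_mul, mul_assoc]
    · simp [sub_mul, mul_assoc, PowerSeries.coeff_succ_X_mul, PowerSeries.coeff_one]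
      norm_num
    · simp [sub_mul, mul_assoc, PowerSeries.coeff_succ_X_mul, PowerSeries.coeff_one]
  have hW : codeSeries k = PowerSeries.mk (fun n => (n : ℂ) - 1) := by
    rw [hD, ← hM] at h
    refine mul_left_cancel₀ (fun h0 => ?_) h
    rw [h0, zero_mul] at hM
    have := congrArg (PowerSeries.coeff 0) hM
    simp at this
  have hc : ∀ n ≠ 0, (codeCount k n : ℝ) = n + 1 := by
    intro n hn
    have := coeff_codeSeries hk0 hn
    rw [hW, PowerSeries.coeff_mk, hk] at this
    have h2 : ((codeCount k n : ℝ) : ℂ) = ((n + 1 : ℝ) : ℂ) := by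
      push_cast at this ⊢
      linear_combination -this
    exact_mod_cast h2
  have ht := (tendsto_one_div_add_atTop_nhds_zero_nat (𝕜 := ℝ)).const_add 1
  rw [add_zero] at ht
  refine ht.congr' ?_
  filter_upwards [eventually_ne_atTop 0] with n hn
  rw [countRatio, hc n hn, hc (n + 1) (by omega)]
  push_cast
  have : (n : ℝ) + 1 ≠ 0 := by positivity
  field_simp

theorem exists_isDominantRoot_zero {L : ℕ} (hL : 3 ≤ L) : ∃ ρ, IsDominantRoot {0} L ρ :=
  exists_isDominantRoot hL (by simp; omega) (mem_singleton_self 0) (by simp)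

theorem tendsto_countRatio_of_one_mem_periods {k : List Bool} (h : 1 ∈ periods k) :
    Tendsto (countRatio k) atTop (𝓝 (alpha (k.length + 1))) := by
  have hl := (mem_periods.1 h).1
  obtain ⟨ρ, hρ⟩ := exists_isDominantRoot_zero (L := k.length + 1) (by omega)
  rw [hρ.alpha_eq (by omega)]
  refine hρ.tendsto_countRatio_of_periods_eq_range ?_ (periods_eq_range_of_one_mem h)
  rintro rfl; simp at hl

/-- At ρ the denominator of the full period set is at most that of `S`, which is 0; the factor 1 - ρ
> 0 preserves the sign. -/
theorem IsDominantRoot.le_of_zero_succ {S : Finset ℕ} {L : ℕ} {ρ ρ' : ℝ} (hS : S ⊆ range L)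
    (h : IsDominantRoot S L ρ) (h' : IsDominantRoot {0} (L + 1) ρ') : ρ' ≤ ρ := by
  have h1 := h.half_lt
  refine h'.le_of_denom_nonpos (mem_singleton_self 0) (by omega) (by linarith) ?_
  rw [← one_sub_mul_denom_range]
  refine mul_nonpos_of_nonneg_of_nonpos (by linarith [h.lt_one]) ?_
  exact (denom_le_denom_of_subset hS L h1.le).trans_eq h.denom_eq_zero

theorem alpha_le_alpha_succ {L : ℕ} (hL : 1 ≤ L) : alpha L ≤ alpha (L + 1) := by
  have h3 : 3 ≤ L ∨ L = 1 ∨ L = 2 := by omega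
  rcases h3 with h3 | rfl | rfl
  · obtain ⟨ρ, hρ⟩ := exists_isDominantRoot_zero h3
    obtain ⟨ρ', hρ'⟩ := exists_isDominantRoot_zero (L := L + 1) (by omega)
    rw [hρ.alpha_eq (by omega), hρ'.alpha_eq (by omega)]
    exact one_div_le_one_div_of_le (by linarith [hρ'.half_lt])
      (hρ.le_of_zero_succ (by simp; omega) hρ')
  · rw [alpha_one, alpha_two]
  · obtain ⟨ρ', hρ'⟩ := exists_isDominantRoot_zero (L := 2 + 1) (by omega)
    rw [alpha_two, hρ'.alpha_eq (by omega)]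
    exact one_le_one_div (by linarith [hρ'.half_lt]) hρ'.lt_one.le

/-! ### Existence of the limit and its extremes -/

theorem exists_tendsto_countRatio {L : ℕ} (hL : 1 ≤ L) {k : List Bool} (hk : k.length = L) :
    ∃ g, Tendsto (countRatio k) atTop (𝓝 g) ∧ alpha L ≤ g ∧ g ≤ alpha (L + 1) := by
  by_cases h1 : 1 ∈ periods k
  · exact ⟨_, tendsto_countRatio_of_one_mem_periods h1, by rw [hk]; exact alpha_le_alpha_succ hL,
      by rw [hk]⟩
  have h3 : 3 ≤ L ∨ L = 1 ∨ L = 2 := by omega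
  rcases h3 with h3 | rfl | rfl
  · have hk0 : k ≠ [] := by rintro rfl; simp at hk; omega
    have hS := periods_subset k
    obtain ⟨ρ, hρ⟩ := exists_isDominantRoot (by omega) hS (zero_mem_periods hk0) h1
    obtain ⟨ρ₀, hρ₀⟩ := exists_isDominantRoot_zero h3
    obtain ⟨ρ₁, hρ₁⟩ := exists_isDominantRoot_zero (L := L + 1) (by omega)
    refine ⟨1 / ρ, hρ.tendsto_countRatio hk0, ?_, ?_⟩
    · rw [hρ₀.alpha_eq (by omega)]
      refine one_div_le_one_div_of_le (by linarith [hρ.half_lt])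
        (hρ.le_of_denom_nonpos (zero_mem_periods hk0) (by omega) (by linarith [hρ₀.half_lt]) ?_)
      rw [hk]
      exact (denom_le_denom_of_subset (singleton_subset_iff.2 (zero_mem_periods hk0)) L
        hρ₀.half_lt.le).trans_eq hρ₀.denom_eq_zero
    · rw [hρ₁.alpha_eq (by omega)]
      rw [hk] at hS hρ
      exact one_div_le_one_div_of_le (by linarith [hρ₁.half_lt]) (hρ.le_of_zero_succ hS hρ₁)
  · exact ⟨1, tendsto_countRatio_of_length_one hk, by rw [alpha_one], by rw [alpha_two]⟩
  · refine ⟨1, tendsto_countRatio_of_length_two hk h1, by rw [alpha_two], ?_⟩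
    have := alpha_le_alpha_succ (L := 2) (by norm_num)
    rwa [alpha_two] at this

theorem tendsto_countRatio_zeroWord {L : ℕ} (hL : 1 ≤ L) :
    Tendsto (countRatio (zeroWord L)) atTop (𝓝 (alpha (L + 1))) := by
  have hl : (zeroWord L).length = L := by simp [zeroWord]
  obtain rfl | h2 := hL.eq_or_lt
  · rw [alpha_two]
    exact tendsto_countRatio_of_length_one hl
  · have := tendsto_countRatio_of_one_mem_periods (k := zeroWord L)
      (by rw [zeroWord, periods_replicate]; simpa using h2)
    rwa [hl] at this

theorem tendsto_countRatio_zeroOneWord {L : ℕ} (hL : 1 ≤ L) :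
    Tendsto (countRatio (zeroOneWord L)) atTop (𝓝 (alpha L)) := by
  have hl := length_zeroOneWord hL
  have hp := periods_zeroOneWord hL
  have h3 : 3 ≤ L ∨ L = 1 ∨ L = 2 := by omega
  rcases h3 with h3 | rfl | rfl
  · obtain ⟨ρ, hρ⟩ := exists_isDominantRoot_zero h3
    rw [hρ.alpha_eq (by omega)]
    refine IsDominantRoot.tendsto_countRatio (by simp [zeroOneWord]) ?_
    rwa [hp, hl]
  · rw [alpha_one]
    exact tendsto_countRatio_of_length_one hl
  · rw [alpha_two]
    exact tendsto_countRatio_of_length_two hl (by simp [hp])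

/-! ### Asymptotics of `alpha L` -/

theorem two_sub_alpha_div_bounds {L : ℕ} (hL : 4 ≤ L) :
    1 ≤ (2 - alpha L) / (2 : ℝ) ^ (-(L : ℤ) + 1) ∧
      (2 - alpha L) / (2 : ℝ) ^ (-(L : ℤ) + 1) ≤ Real.exp (L * (68 / 125) ^ L) := by
  obtain ⟨ρ, hρ, hlt⟩ := exists_isDominantRoot_of_four_le (S := {0}) hL (by simp; omega)
    (mem_singleton_self 0) (by simp)
  have hpos : 0 < ρ := by linarith [hρ.half_lt]
  have hd := hρ.denom_eq_zero
  simp only [denom, sum_singleton, pow_zero, mul_one] at hd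
  obtain ⟨m, rfl⟩ : ∃ m, L = m + 1 := ⟨L - 1, by omega⟩
  have h2 : 2 * ρ = 1 + ρ ^ (m + 1) := by linarith
  -- By `h2`, 2 - 1/ρ = (2ρ - 1)/ρ = ρ^m, so the quotient is (2ρ)^m.
  have he : (2 - alpha (m + 1)) / (2 : ℝ) ^ (-((m + 1 : ℕ) : ℤ) + 1) = (1 + ρ ^ (m + 1)) ^ m := by
    rw [hρ.alpha_eq (by omega), ← h2, mul_pow]
    have h3 : (-((m + 1 : ℕ) : ℤ) + 1) = -(m : ℤ) := by push_cast; ring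
    rw [h3, zpow_neg, zpow_natCast, div_inv_eq_mul, mul_comm]
    congr 1
    rw [pow_succ] at hd
    field_simp
    linarith
  rw [he]
  constructor
  · exact one_le_pow₀ (by linarith [pow_pos hpos (m + 1)])
  · have h4 : 1 + ρ ^ (m + 1) ≤ Real.exp (ρ ^ (m + 1)) := by
      linarith [Real.add_one_le_exp (ρ ^ (m + 1))]
    have h5 : 0 ≤ 1 + ρ ^ (m + 1) := by positivity
    calc (1 + ρ ^ (m + 1)) ^ m ≤ Real.exp (ρ ^ (m + 1)) ^ m := pow_le_pow_left₀ h5 h4 m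
      _ = Real.exp (m * ρ ^ (m + 1)) := (Real.exp_nat_mul _ _).symm
      _ ≤ _ := by
        refine Real.exp_le_exp.2 (mul_le_mul ?_ ?_ (by positivity) (by positivity))
        · push_cast; linarith
        · exact pow_le_pow_left₀ hpos.le hlt.le _

theorem two_sub_alpha_isEquivalent :
    (fun L : ℕ => 2 - alpha L) ~[atTop] fun L : ℕ => (2 : ℝ) ^ (-(L : ℤ) + 1) := by
  refine isEquivalent_of_tendsto_one ?_
  have h1 : Tendsto (fun L : ℕ => Real.exp (L * (68 / 125) ^ L)) atTop (𝓝 1) := by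
    have := tendsto_self_mul_const_pow_of_lt_one (r := (68 / 125 : ℝ)) (by norm_num) (by norm_num)
    have h := (Real.continuous_exp.tendsto 0).comp this
    rw [Real.exp_zero] at h
    exact h
  refine tendsto_of_tendsto_of_tendsto_of_le_of_le' tendsto_const_nhds h1 ?_ ?_
  · filter_upwards [eventually_ge_atTop 4] with L hL
    exact (two_sub_alpha_div_bounds hL).1
  · filter_upwards [eventually_ge_atTop 4] with L hL
    exact (two_sub_alpha_div_bounds hL).2

end UDOOC

theorem mainTheorem4 :
    (∀ L : ℕ, 1 ≤ L →
      (∀ k : List Bool, k.length = L →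
        Tendsto (UDOOC.countRatio k) atTop (𝓝 (UDOOC.growthRate k))) ∧
      (∀ k : List Bool, k.length = L →
        UDOOC.growthRate (UDOOC.zeroOneWord L) ≤ UDOOC.growthRate k ∧
        UDOOC.growthRate k ≤ UDOOC.growthRate (UDOOC.zeroWord L)) ∧
      UDOOC.growthRate (UDOOC.zeroWord L) = UDOOC.alpha (L + 1) ∧
      UDOOC.growthRate (UDOOC.zeroOneWord L) = UDOOC.alpha L) ∧
    (fun L : ℕ => 2 - UDOOC.alpha L) ~[atTop] (fun L : ℕ => (2 : ℝ) ^ (-(L : ℤ) + 1)) := by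
  refine ⟨fun L hL => ?_, UDOOC.two_sub_alpha_isEquivalent⟩
  have h0 : UDOOC.growthRate (UDOOC.zeroWord L) = UDOOC.alpha (L + 1) :=
    (UDOOC.tendsto_countRatio_zeroWord hL).limUnder_eq
  have h1 : UDOOC.growthRate (UDOOC.zeroOneWord L) = UDOOC.alpha L :=
    (UDOOC.tendsto_countRatio_zeroOneWord hL).limUnder_eq
  refine ⟨fun k hk => ?_, fun k hk => ?_, h0, h1⟩
  · obtain ⟨g, hg, -⟩ := UDOOC.exists_tendsto_countRatio hL hk
    rwa [UDOOC.growthRate, hg.limUnder_eq]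
  · obtain ⟨g, hg, h2, h3⟩ := UDOOC.exists_tendsto_countRatio hL hk
    rw [h0, h1, UDOOC.growthRate, hg.limUnder_eq]
    exact ⟨h2, h3⟩
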